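/- A \emph{bimodal formula} is built from countably many propositional variables by $\neg$, $\wedge$, $\Diamond_0$, $\Diamond_1$, interpreted in Kripke models over 2-frames $\langle W,R_0,R_1\rangle$ ($W\neq\emptyset$, $R_0,R_1\subseteq W\times W$), where $\Diamond_i$ is interpreted by $R_i$. Let $\mathcal C_{\mathit{lin}}^{\mathit{fin}}$ be the class of all finite (irreflexive) linear orders $\langle W,<\rangle$ with $W\ne\emptyset$, and $\mathcal C_{\mathit{diff}}$ the class of all difference frames $\langle W,\neq\rangle$ with $W\ne\emptyset$. For classes $\mathcal C_0,\mathcal C_1$ of frames (non-empty sets with one binary relation), $\mathcal C_0\times^e\mathcal C_1$ is the class of all expanding 2-frames: given $\langle W,R\rangle\in\mathcal C_0$ and frames $\langle W_x,R_x\rangle\in\mathcal C_1$ ($x\in W$) such that $W_x\subseteq W_y$ and $R_x=R_y\cap(W_x\times W_x)$ whenever $xRy$, the 2-frame has the points $\langle x,v\rangle$ with $x\in W$, $v\in W_x$, and $\langle x,v\rangle R_0\langle x',v'\rangle$ iff $xRx'$ and $v=v'$, while $\langle x,v\rangle R_1\langle x',v'\rangle$ iff $vR_xv'$ and $x=x'$.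 \textbf{Theorem.} (i) $\mathcal C_{\mathit{lin}}^{\mathit{fin}}\times^e\mathcal C_{\mathit{diff}}$-satisfiability is decidable: there is an algorithm that, given a bimodal formula $\phi$, decides whether $\phi$ is true at some point of some model based on a 2-frame in $\mathcal C_{\mathit{lin}}^{\mathit{fin}}\times^e\mathcal C_{\mathit{diff}}$. (ii) Consequently, $\mathrm{FOLTL}^{\neq}$-satisfiability is decidable in expanding domain models over the class of all finite linear orders. Here $\mathrm{FOLTL}^{\neq}$-formulas are built from countably many monadic atoms $P(x)$, all with the same single variable $x$, by $\neg$, $\wedge$, $\Diamond_F$ and $\exists^{\neq}x$. An expanding domain model over a linear order $\langle T,<\rangle$ has non-empty domains $D_t$ ($t\in T$) with $D_t\subseteq D_{t'}$ whenever $t<t'$, and an interpretation of each $P$ as a subset of $D_t$ at each $t\in T$. Truth at $t\in T$ under an assignment $a\in D_t$ to $x$ is as usual for the atoms and the Booleans; $\exists^{\neq}x\,\phi$ is true at $t$ under $a$ iff $\phi$ is true at $t$ under some $b\in D_t$ with $b\neq a$, and $\Diamond_F\phi$ is true at $t$ under $a$ iff $\phi$ is true under $a$ at some $t'>t$ with $a\in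 D_{t'}$. A formula is satisfiable in a model if it is true at some $t\in T$ under some $a\in D_t$. -/

import Mathlib

universe u

namespace BimodalLogic

/-! ### Bimodal formulas and their Gödel numbering -/

/-- Bimodal formulas over the propositional variables `var 0, var 1, var 2, …`. -/
inductive Formula : Type
  | var : ℕ → Formula
  | neg : Formula → Formula
  | and : Formula → Formula → Formula
  | dia0 : Formula → Formula
  | dia1 : Formula → Formula

namespace Formula

/-- The Gödel number of a bimodal formula. -/
def toNat : Formula → ℕ
  | var n => 5 * n
  | neg φ => 5 * φ.toNat + 1
  | and φ ψ => 5 * Nat.pair φ.toNat ψ.toNat + 2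
  | dia0 φ => 5 * φ.toNat + 3
  | dia1 φ => 5 * φ.toNat + 4

/-- The bimodal formula with a given Gödel number. -/
def ofNat (n : ℕ) : Formula :=
  if n % 5 = 0 then var (n / 5)
  else if n % 5 = 1 then neg (ofNat (n / 5))
  else if n % 5 = 2 then and (ofNat (n / 5).unpair.1) (ofNat (n / 5).unpair.2)
  else if n % 5 = 3 then dia0 (ofNat (n / 5))
  else dia1 (ofNat (n / 5))
termination_by n
decreasing_by
  · omega
  · have := Nat.unpair_left_le (n / 5); omega
  · have := Nat.unpair_right_le (n / 5); omega
  · omega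
  · omega

theorem ofNat_toNat (φ : Formula) : ofNat φ.toNat = φ := by
  induction φ with
  | var n => rw [toNat, ofNat]; simp
  | neg φ ih =>
    rw [toNat, ofNat]
    have h1 : (5 * φ.toNat + 1) % 5 = 1 := by omega
    have h2 : (5 * φ.toNat + 1) / 5 = φ.toNat := by omega
    simp [h1, h2, ih]
  | and φ ψ ih1 ih2 =>
    rw [toNat, ofNat]
    have h1 : (5 * Nat.pair φ.toNat ψ.toNat + 2) % 5 = 2 := by omega
    have h2 : (5 * Nat.pair φ.toNat ψ.toNat + 2) / 5 = Nat.pair φ.toNat ψ.toNat := by omega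
    simp [h1, h2, ih1, ih2]
  | dia0 φ ih =>
    rw [toNat, ofNat]
    have h1 : (5 * φ.toNat + 3) % 5 = 3 := by omega
    have h2 : (5 * φ.toNat + 3) / 5 = φ.toNat := by omega
    simp [h1, h2, ih]
  | dia1 φ ih =>
    rw [toNat, ofNat]
    have h1 : (5 * φ.toNat + 4) % 5 = 4 := by omega
    have h2 : (5 * φ.toNat + 4) / 5 = φ.toNat := by omega
    simp [h1, h2, ih]

theorem toNat_ofNat (n : ℕ) : (ofNat n).toNat = n := by
  induction n using Nat.strong_induction_on with
  | _ n ih =>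
    rw [ofNat]
    split_ifs with h0 h1 h2 h3
    · rw [toNat]; omega
    · rw [toNat, ih _ (by omega)]; omega
    · have hl := Nat.unpair_left_le (n / 5)
      have hr := Nat.unpair_right_le (n / 5)
      rw [toNat, ih _ (by omega), ih _ (by omega), Nat.pair_unpair]; omega
    · rw [toNat, ih _ (by omega)]; omega
    · rw [toNat, ih _ (by omega)]; omega

/-- The Gödel numbering as a bijection with `ℕ`. -/
def equivNat : Formula ≃ ℕ := ⟨toNat, ofNat, ofNat_toNat, toNat_ofNat⟩

instance : Denumerable Formula := Denumerable.mk' equivNat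

end Formula

/-! ### Frames, models, truth -/

/-- A (unimodal) frame: a non-empty set with a binary relation. -/
structure Frame : Type (u + 1) where
  World : Type u
  nonempty : Nonempty World
  Rel : World → World → Prop

/-- A 2-frame: a non-empty set with two binary relations. -/
structure Frame2 : Type (u + 1) where
  World : Type u
  nonempty : Nonempty World
  R0 : World → World → Prop
  R1 : World → World → Prop

/-- The truth relation at `w` in the model based on the 2-frame `K` with valuation `ν`. -/
def Truth (K : Frame2.{u}) (ν : ℕ → Set K.World) : Formula → K.World → Prop
  | .var n, w => w ∈ ν n
  | .neg φ, w => ¬ Truth K ν φ w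
  | .and φ ψ, w => Truth K ν φ w ∧ Truth K ν ψ w
  | .dia0 φ, w => ∃ v, K.R0 w v ∧ Truth K ν φ v
  | .dia1 φ, w => ∃ v, K.R1 w v ∧ Truth K ν φ v

/-- `φ` is `C`-satisfiable: it is satisfied in some model based on a 2-frame in `C`. -/
def Satisfiable (C : Set Frame2.{u}) (φ : Formula) : Prop :=
  ∃ K ∈ C, ∃ (ν : ℕ → Set K.World) (w : K.World), Truth K ν φ w

/-! ### Expanding 2-frames -/

/-- A sequence of (vertical) frames indexed by the worlds of the (horizontal) frame `F`. The sets
of worlds of the vertical frames are subsets `dom x` of one ambient type, so that they can be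
compared by inclusion; only the restriction of `rel x` to `dom x` matters. -/
structure VerticalFrames (F : Frame.{u}) : Type (u + 1) where
  Ambient : Type u
  dom : F.World → Set Ambient
  dom_nonempty : ∀ x, (dom x).Nonempty
  rel : F.World → Ambient → Ambient → Prop

namespace VerticalFrames

variable {F : Frame.{u}}

/-- The vertical frame at `x`. -/
def frame (G : VerticalFrames F) (x : F.World) : Frame.{u} where
  World := G.dom x
  nonempty := (G.dom_nonempty x).to_subtype
  Rel a b := G.rel x a b

/-- The 2-frame built from `F` and the vertical frames `G`. -/
def twoFrame (G : VerticalFrames F) : Frame2.{u} where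
  World := {p : F.World × G.Ambient // p.2 ∈ G.dom p.1}
  nonempty := by
    obtain ⟨x⟩ := F.nonempty
    obtain ⟨a, ha⟩ := G.dom_nonempty x
    exact ⟨⟨(x, a), ha⟩⟩
  R0 p q := F.Rel p.1.1 q.1.1 ∧ p.1.2 = q.1.2
  R1 p q := G.rel p.1.1 p.1.2 q.1.2 ∧ p.1.1 = q.1.1

/-- The vertical frame at `x` is a subframe of the vertical frame at `y` whenever `x R y`. -/
def IsExpanding (G : VerticalFrames F) : Prop :=
  ∀ x y, F.Rel x y →
    G.dom x ⊆ G.dom y ∧ ∀ a ∈ G.dom x, ∀ b ∈ G.dom x, (G.rel x a b ↔ G.rel y a b)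

end VerticalFrames

/-- The class `C₀ ×ᵉ C₁` of expanding 2-frames with horizontal frame in `C₀` and all vertical
frames in `C₁`. -/
def expandingProduct (C₀ C₁ : Set Frame.{u}) : Set Frame2.{u} :=
  {K | ∃ (F : Frame.{u}) (G : VerticalFrames F),
    F ∈ C₀ ∧ (∀ x, G.frame x ∈ C₁) ∧ G.IsExpanding ∧ K = G.twoFrame}

/-- The class of all (strict) linear orders. -/
def linearFrames : Set Frame.{u} :=
  {F | (∀ x, ¬ F.Rel x x) ∧ (∀ x y z, F.Rel x y → F.Rel y z → F.Rel x z) ∧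
    ∀ x y, F.Rel x y ∨ x = y ∨ F.Rel y x}

/-- The class of all finite linear orders. -/
def finiteLinearFrames : Set Frame.{u} :=
  {F | F ∈ linearFrames ∧ Finite F.World}

/-- The class of all difference frames. -/
def differenceFrames : Set Frame.{u} :=
  {F | ∀ x y, F.Rel x y ↔ x ≠ y}

/-! ### One-variable first-order linear temporal logic with counting to two -/

/-- FOLTL≠-formulas: `pred n` is the atomic formula `Pₙ(x)`, `eventually` is the temporal operator
"eventually" (at some strictly later moment), and `exNe` is the quantifier `∃^≠ x`. -/
inductive FOFormula : Type
  | pred : ℕ → FOFormula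
  | neg : FOFormula → FOFormula
  | and : FOFormula → FOFormula → FOFormula
  | eventually : FOFormula → FOFormula
  | exNe : FOFormula → FOFormula

namespace FOFormula

/-- The notational bijection from FOLTL≠-formulas to bimodal formulas. -/
def star : FOFormula → Formula
  | pred n => .var n
  | neg φ => .neg φ.star
  | and φ ψ => .and φ.star ψ.star
  | eventually φ => .dia0 φ.star
  | exNe φ => .dia1 φ.star

/-- The inverse of `star`. -/
def unstar : Formula → FOFormula
  | .var n => pred n
  | .neg φ => neg (unstar φ)
  | .and φ ψ => and (unstar φ) (unstar ψ)
  | .dia0 φ => eventually (unstar φ)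
  | .dia1 φ => exNe (unstar φ)

/-- The translation `star` as an equivalence. -/
def starEquiv : FOFormula ≃ Formula where
  toFun := star
  invFun := unstar
  left_inv φ := by induction φ <;> simp_all [star, unstar]
  right_inv φ := by induction φ <;> simp_all [star, unstar]

/-- FOLTL≠-formulas get the Gödel numbers of their bimodal translations. -/
instance : Denumerable FOFormula := Denumerable.ofEquiv Formula starEquiv

end FOFormula

/-- A FOLTL-model based on the timeline `F`: the domains `dom t` are non-empty subsets of one
type of objects, and `I t n` is the interpretation of the `n`-th monadic predicate symbol at the
moment `t`. -/
structure FOModel (F : Frame.{u}) : Type (u + 1) where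
  Obj : Type u
  dom : F.World → Set Obj
  dom_nonempty : ∀ t, (dom t).Nonempty
  I : (t : F.World) → ℕ → Set (dom t)

namespace FOModel

variable {F : Frame.{u}}

/-- `M.Truth φ t a` says that `φ` is true at the moment `t` when `x` denotes `a`. -/
def Truth (M : FOModel F) : FOFormula → (t : F.World) → M.dom t → Prop
  | .pred n, t, a => a ∈ M.I t n
  | .neg φ, t, a => ¬ M.Truth φ t a
  | .and φ ψ, t, a => M.Truth φ t a ∧ M.Truth ψ t a
  | .eventually φ, t, a => ∃ t', F.Rel t t' ∧ ∃ h : (a : M.Obj) ∈ M.dom t', M.Truth φ t' ⟨a, h⟩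
  | .exNe φ, t, a => ∃ b, b ≠ a ∧ M.Truth φ t b

/-- Expanding domains. -/
def IsExpanding (M : FOModel F) : Prop :=
  ∀ t t', F.Rel t t' → M.dom t ⊆ M.dom t'

end FOModel

/-- `φ` is FOLTL≠-satisfiable in expanding domain models over the class `C` of linear orders. -/
def FOSatisfiableExpanding (C : Set Frame.{u}) (φ : FOFormula) : Prop :=
  ∃ F ∈ C, ∃ M : FOModel F, M.IsExpanding ∧ ∃ (t : F.World) (a : M.dom t), M.Truth φ t a

end BimodalLogic

namespace BimodalLogic

/-! ### Types as bit masks and configurations as lists of types -/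

/-! The plan is to turn satisfiability into reachability in a well-structured transition system and
to decide it by forward search. Let `N` be the Gödel number of the formula. All subformulas have
codes at most `N`, so the type of an element at a moment is the set of codes up to `N` true there,
stored as a bit mask. A difference diamond sees only which types occur at its moment and which occur
at least twice. A moment thus becomes a finite list of types, and a model becomes a run: along a
step elements persist with compatible types while new ones may appear, and at the last moment no
temporal diamond holds. Only the future of the evaluation point matters, so runs start there. Finite
domains suffice, because two witnesses per moment and formula serve every difference diamond, and
temporal diamonds never leave their element (`holdsSomewhere_iff`). Smaller configurations are
better. `Final` passes to sublists, and a sublist of `d` can imitate each step of `d` by moving to a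
sublist of the target. After pruning, that sublist exceeds its source by at most two copies of each
type (`Next.exists_mem_nexts`). Hence it is enough to follow the finitely branching pruned steps, up
to the sublist order. Higman's lemma makes this enumeration stabilise (`exists_stable`), one further
round detects stability, and then only finitely many configurations need testing for `Final`. Each
ingredient is primitive recursive, except the unbounded search for the stable stage. -/

/-- The mask `τ` respects negation and conjunction among the formulas with codes up to `N`. -/
def BoolCoherent (N τ : ℕ) : Prop :=
  ∀ k < N + 1, (k % 5 = 1 → (τ.testBit k ↔ ¬ τ.testBit (k / 5))) ∧
    (k % 5 = 2 → (τ.testBit k ↔ τ.testBit (k / 5).unpair.1 ∧ τ.testBit (k / 5).unpair.2))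

/-- An element of type `τ` may have type `σ` at the next moment. -/
def TemporalStep (N τ σ : ℕ) : Prop :=
  ∀ k < N + 1, k % 5 = 3 → (τ.testBit k ↔ σ.testBit (k / 5) ∨ σ.testBit k)

/-- An element of type `τ` may exist at the last moment. -/
def Terminal (N τ : ℕ) : Prop :=
  ∀ k < N + 1, k % 5 = 3 → ¬ τ.testBit k

/-- The list `e` lists the types realised at some moment, with multiplicities. -/
def Valid (N : ℕ) (e : List ℕ) : Prop :=
  ∀ τ ∈ e, τ < 2 ^ (N + 1) ∧ BoolCoherent N τ ∧
    ∀ k < N + 1, k % 5 = 4 →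
      (τ.testBit k ↔ ∃ σ ∈ e, σ.testBit (k / 5) ∧ (σ ≠ τ ∨ [τ, τ].Sublist e))

/-- A valid configuration realising the formula with code `N`. -/
def Initial (N : ℕ) (e : List ℕ) : Prop :=
  Valid N e ∧ ∃ τ ∈ e, τ.testBit N

/-- The configuration `e` may follow `d`: every element of `d` persists, and new ones may appear. -/
def Next (N : ℕ) (d e : List ℕ) : Prop :=
  Valid N e ∧ List.SublistForall₂ (TemporalStep N) d e

/-- The configuration may be the last one. -/
def Final (N : ℕ) (e : List ℕ) : Prop :=
  ∀ τ ∈ e, Terminal N τ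

/-- Configurations reachable from the initial ones. -/
inductive Reachable (N : ℕ) : List ℕ → Prop
  | init {e : List ℕ} : Initial N e → Reachable N e
  | step {d e : List ℕ} : Reachable N d → Next N d e → Reachable N e

theorem Reachable.valid {N : ℕ} {e : List ℕ} (h : Reachable N e) : Valid N e := by
  cases h with
  | init h => exact h.1
  | step _ h => exact h.1

theorem Final.of_sublist {N : ℕ} {d e : List ℕ} (h : Final N e) (hd : d.Sublist e) : Final N d :=
  fun τ hτ => h τ (hd.subset hτ)

/-! ### Sublists and pruning -/

/-- Elements dropped from the source leave their partners in the target as newcomers. This makes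
steps compatible with the sublist order. -/
theorem SublistForall₂.of_sublist_left {α β : Type*} {R : α → β → Prop} {u d : List α}
    {e : List β} (h : List.SublistForall₂ R d e) (hu : u.Sublist d) :
    List.SublistForall₂ R u e := by
  induction h generalizing u with
  | nil => rw [List.sublist_nil.1 hu]; exact .nil
  | cons hab _ ih =>
    cases hu with
    | cons _ hu => exact .cons_right (ih hu)
    | cons_cons _ hu => exact .cons hab (ih hu)
  | cons_right _ ih => exact .cons_right (ih hu)

/-- Two sublists of a list are contained in a sublist that is no longer than both together. -/
theorem exists_sublist_join {α : Type*} {u v e : List α} (hu : u.Sublist e) (hv : v.Sublist e) :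
    ∃ x : List α, u.Sublist x ∧ v.Sublist x ∧ x.Sublist e ∧ x.length ≤ u.length + v.length := by
  induction e generalizing u v with
  | nil =>
    rw [List.sublist_nil.1 hu, List.sublist_nil.1 hv]
    exact ⟨[], by simp⟩
  | cons a e ih =>
    cases hu with
    | cons _ hu =>
      cases hv with
      | cons _ hv =>
        obtain ⟨x, h1, h2, h3, h4⟩ := ih hu hv
        exact ⟨x, h1, h2, h3.cons a, h4⟩
      | cons_cons _ hv =>
        obtain ⟨x, h1, h2, h3, h4⟩ := ih hu hv
        exact ⟨a :: x, h1.cons a, h2.cons_cons a, h3.cons_cons a, by simp; omega⟩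
    | cons_cons _ hu =>
      cases hv with
      | cons _ hv =>
        obtain ⟨x, h1, h2, h3, h4⟩ := ih hu hv
        exact ⟨a :: x, h1.cons_cons a, h2.cons a, h3.cons_cons a, by simp; omega⟩
      | cons_cons _ hv =>
        obtain ⟨x, h1, h2, h3, h4⟩ := ih hu hv
        exact ⟨a :: x, h1.cons_cons a, h2.cons_cons a, h3.cons_cons a, by simp; omega⟩

/-- Each type below `n` is treated in turn, and up to two of its occurrences in `e` are joined to
`w`. Two are enough to record whether it occurs and whether it repeats. -/
theorem exists_sublist_pairs {w e : List ℕ} (hw : w.Sublist e) (n : ℕ) :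
    ∃ x : List ℕ, w.Sublist x ∧ x.Sublist e ∧ x.length ≤ w.length + 2 * n ∧
      ∀ τ < n, (τ ∈ e → τ ∈ x) ∧ ([τ, τ].Sublist e → [τ, τ].Sublist x) := by
  induction n with
  | zero => exact ⟨w, .refl w, hw, by simp, by simp⟩
  | succ n ih =>
    obtain ⟨x, h1, h2, h3, h4⟩ := ih
    obtain ⟨v, hv, hl, hm⟩ : ∃ v : List ℕ, v.Sublist e ∧ v.length ≤ 2 ∧
        ((n ∈ e → n ∈ v) ∧ ([n, n].Sublist e → [n, n].Sublist v)) := by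
      by_cases hn : [n, n].Sublist e
      · exact ⟨[n, n], hn, by simp, by simp⟩
      by_cases hn' : n ∈ e
      · exact ⟨[n], List.singleton_sublist.2 hn', by simp, by simp, fun h => absurd h hn⟩
      · exact ⟨[], by simp, by simp, fun h => absurd h hn', fun h => absurd h hn⟩
    obtain ⟨y, g1, g2, g3, g4⟩ := exists_sublist_join h2 hv
    refine ⟨y, h1.trans g1, g3, by omega, fun τ hτ => ?_⟩
    rcases Nat.lt_succ_iff_lt_or_eq.1 hτ with hτ | rfl
    · exact ⟨fun h => g1.subset ((h4 τ hτ).1 h), fun h => ((h4 τ hτ).2 h).trans g1⟩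
    · exact ⟨fun h => g2.subset (hm.1 h), fun h => (hm.2 h).trans g2⟩

/-- A sublist of a valid configuration extends to a valid sublist with boundedly many new
members. -/
theorem Valid.exists_prune {N : ℕ} {w e : List ℕ} (he : Valid N e) (hw : w.Sublist e) :
    ∃ x : List ℕ, Valid N x ∧ w.Sublist x ∧ x.Sublist e ∧
      x.length ≤ w.length + 2 * 2 ^ (N + 1) := by
  obtain ⟨x, h1, h2, h3, h4⟩ := exists_sublist_pairs hw (2 ^ (N + 1))
  -- Validity of a list depends only on which types occur and which occur twice, and `x` agrees with
  -- `e` on both.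
  refine ⟨x, fun τ hτ => ?_, h1, h2, h3⟩
  obtain ⟨hb, hc, hd⟩ := he τ (h2.subset hτ)
  refine ⟨hb, hc, fun k hk hk4 => (hd k hk hk4).trans ⟨?_, ?_⟩⟩
  · rintro ⟨σ, hσ, hbit, h⟩
    exact ⟨σ, (h4 σ (he σ hσ).1).1 hσ, hbit, h.imp_right (h4 τ hb).2⟩
  · rintro ⟨σ, hσ, hbit, h⟩
    exact ⟨σ, h2.subset hσ, hbit, h.imp_right fun h => h.trans h2⟩

/-! ### Enumeration of the reachable configurations -/

/-- The sublists of a list. -/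
def allSublists (l : List ℕ) : List (List ℕ) :=
  l.foldr (fun a acc => acc ++ acc.map (List.cons a)) [[]]

theorem mem_allSublists {l w : List ℕ} : w ∈ allSublists l ↔ w.Sublist l := by
  induction l generalizing w with
  | nil => simp [allSublists]
  | cons a l ih =>
    have : allSublists (a :: l) = allSublists l ++ (allSublists l).map (List.cons a) := rfl
    simp only [this, List.mem_append, List.mem_map, ih, List.sublist_cons_iff]
    constructor
    · rintro (h | ⟨r, h, rfl⟩)
      · exact .inl h
      · exact .inr ⟨r, rfl, h⟩
    · rintro (h | ⟨r, rfl, h⟩)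
      · exact .inl h
      · exact .inr ⟨r, h, rfl⟩

/-- A list containing all configurations of length at most `L`. -/
def candidates (N L : ℕ) : List (List ℕ) :=
  allSublists ((List.range L).flatMap fun _ => List.range (2 ^ (N + 1)))

/-- The ambient list is `L` copies of the full alphabet, and the i-th entry of `e` is picked from
the i-th copy. -/
theorem mem_candidates {N L : ℕ} {e : List ℕ} (hl : e.length ≤ L)
    (he : ∀ τ ∈ e, τ < 2 ^ (N + 1)) : e ∈ candidates N L := by
  rw [candidates, mem_allSublists]
  induction e generalizing L with
  | nil => simp
  | cons τ e ih =>
    obtain ⟨L, rfl⟩ : ∃ L', L = L' + 1 := ⟨L - 1, by simp at hl; omega⟩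
    have h1 : [τ].Sublist (List.range (2 ^ (N + 1))) := by
      simpa using he τ (by simp)
    have h2 := ih (L := L) (by simpa using hl) fun σ hσ => he σ (by simp [hσ])
    simpa [List.range_succ_eq_map, List.flatMap_map] using h1.append h2

open Classical in
/-- The minimal initial configurations (among others). -/
noncomputable def initials (N : ℕ) : List (List ℕ) :=
  (candidates N (1 + 2 * 2 ^ (N + 1))).filter (Initial N ·)

open Classical in
/-- The minimal successors of a configuration (among others). -/
noncomputable def nexts (N : ℕ) (d : List ℕ) : List (List ℕ) :=
  (candidates N (d.length + 2 * 2 ^ (N + 1))).filter (Next N d ·)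

/-- The configurations obtained in at most `n` steps. -/
noncomputable def reach (N n : ℕ) : List (List ℕ) :=
  n.rec (initials N) fun _ R => R ++ R.flatMap (nexts N)

theorem reach_mono (N : ℕ) : Monotone (reach N · |>.toFinset) := by
  refine monotone_nat_of_le_succ fun n => ?_
  intro d hd
  simp only [List.mem_toFinset] at hd ⊢
  exact List.mem_append_left _ hd

theorem mem_reach_of_le {N m n : ℕ} (h : m ≤ n) {d : List ℕ} (hd : d ∈ reach N m) :
    d ∈ reach N n :=
  List.mem_toFinset.1 (reach_mono N h (List.mem_toFinset.2 hd))

theorem reachable_of_mem_reach {N n : ℕ} {d : List ℕ} (h : d ∈ reach N n) : Reachable N d := by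
  induction n generalizing d with
  | zero => exact .init (by simpa using (List.mem_filter.1 h).2)
  | succ n ih =>
    rcases List.mem_append.1 h with h | h
    · exact ih h
    · obtain ⟨c, hc, hd⟩ := List.mem_flatMap.1 h
      exact .step (ih hc) (by simpa using (List.mem_filter.1 hd).2)

/-- One occurrence of a type containing `N` is kept and the rest pruned; this is the summand 1 in
the length bound of `initials`. -/
theorem Initial.exists_mem_initials {N : ℕ} {e : List ℕ} (h : Initial N e) :
    ∃ d ∈ initials N, d.Sublist e := by
  obtain ⟨hv, τ, hτ, hb⟩ := h
  obtain ⟨x, hx, h1, h2, h3⟩ := hv.exists_prune (List.singleton_sublist.2 hτ)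
  refine ⟨x, List.mem_filter.2 ⟨mem_candidates (by simpa using h3) fun σ hσ => (hx σ hσ).1, ?_⟩, h2⟩
  simpa using ⟨hx, τ, List.singleton_sublist.1 h1, hb⟩

/-- The partners of `u` in `e` form a sublist as long as `u`, and pruning `e` around them yields a
valid successor of bounded length. -/
theorem Next.exists_mem_nexts {N : ℕ} {u d e : List ℕ} (h : Next N d e) (hu : u.Sublist d) :
    ∃ x ∈ nexts N u, x.Sublist e := by
  obtain ⟨w, hw, hwe⟩ := List.sublistForall₂_iff.1 (SublistForall₂.of_sublist_left h.2 hu)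
  obtain ⟨x, hx, h1, h2, h3⟩ := h.1.exists_prune hwe
  refine ⟨x, List.mem_filter.2 ⟨mem_candidates ?_ fun σ hσ => (hx σ hσ).1, ?_⟩, h2⟩
  · rw [hw.length_eq]; exact h3
  · simpa using ⟨hx, List.sublistForall₂_iff.2 ⟨w, hw, h1⟩⟩

/-- Up to sublists, the enumeration gains nothing at step `n + 1`. -/
def Stable (N n : ℕ) : Prop :=
  ∀ e ∈ reach N (n + 1), ∃ d ∈ reach N n, d.Sublist e

/-- By induction on reachability: a step is imitated from a smaller enumerated configuration,
landing in `reach N (n + 1)`, and stability leads back into `reach N n`. A single stable stage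
therefore covers all later ones. -/
theorem Stable.exists_sublist {N n : ℕ} (h : Stable N n) {e : List ℕ} (he : Reachable N e) :
    ∃ d ∈ reach N n, d.Sublist e := by
  induction he with
  | init he =>
    obtain ⟨d, hd, hde⟩ := he.exists_mem_initials
    exact ⟨d, mem_reach_of_le (Nat.zero_le n) hd, hde⟩
  | step _ hstep ih =>
    obtain ⟨u, hu, hud⟩ := ih
    obtain ⟨x, hx, hxe⟩ := hstep.exists_mem_nexts hud
    obtain ⟨y, hy, hyx⟩ := h x (List.mem_append_right _ (List.mem_flatMap.2 ⟨u, hu, hx⟩))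
    exact ⟨y, hy, hyx.trans hxe⟩

theorem Stable.exists_final_iff {N n : ℕ} (h : Stable N n) :
    (∃ e, Reachable N e ∧ Final N e) ↔ ∃ e ∈ reach N n, Final N e := by
  constructor
  · rintro ⟨e, he, hf⟩
    obtain ⟨d, hd, hde⟩ := h.exists_sublist he
    exact ⟨d, hd, hf.of_sublist hde⟩
  · rintro ⟨e, he, hf⟩
    exact ⟨e, reachable_of_mem_reach he, hf⟩

/-- Higman's lemma for the configurations over a fixed set of formulas. -/
theorem partiallyWellOrderedOn_sublist (B : ℕ) :
    {e : List ℕ | ∀ τ ∈ e, τ < B}.PartiallyWellOrderedOn List.Sublist := by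
  have h : {τ : ℕ | τ < B}.PartiallyWellOrderedOn (· = ·) :=
    (Set.finite_lt_nat B).partiallyWellOrderedOn
  intro f
  obtain ⟨m, n, hmn, hs⟩ :=
    Set.PartiallyWellOrderedOn.partiallyWellOrderedOn_sublistForall₂ (· = ·) h f
  obtain ⟨l, hl, hs⟩ := List.sublistForall₂_iff.1 hs
  rw [List.forall₂_eq_eq_eq] at hl
  subst hl
  exact ⟨m, n, hmn, hs⟩

theorem exists_stable (N : ℕ) : ∃ n, Stable N n := by
  by_contra! hc
  have : ∀ n, ∃ e ∈ reach N (n + 1), ∀ d ∈ reach N n, ¬ d.Sublist e := by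
    intro n
    simpa [Stable] using hc n
  choose f hf hf' using this
  -- If no stage is stable, each `f n` is new at stage `n + 1` up to sublists, so the sequence `f`
  -- is bad in the sense of Higman's lemma.
  obtain ⟨m, n, hmn, hs⟩ := partiallyWellOrderedOn_sublist (2 ^ (N + 1))
    fun n => ⟨f n, fun τ hτ => ((reachable_of_mem_reach (hf n)).valid τ hτ).1⟩
  -- `f m` appears by stage `m + 1`, and `m + 1 ≤ n`.
  exact hf' n (f m) (mem_reach_of_le hmn (hf m)) hs

/-! ### Primitive recursiveness -/

section Primrec

variable {α β : Type*} [Primcodable α] [Primcodable β]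

theorem _root_.PrimrecPred.imp {p q : α → Prop} (hp : PrimrecPred p) (hq : PrimrecPred q) :
    PrimrecPred fun a => p a → q a :=
  (hp.not.or hq).of_eq fun _ => imp_iff_not_or.symm

theorem _root_.PrimrecPred.iff {p q : α → Prop} (hp : PrimrecPred p) (hq : PrimrecPred q) :
    PrimrecPred fun a => (p a ↔ q a) :=
  ((PrimrecPred.imp hp hq).and (PrimrecPred.imp hq hp)).of_eq fun _ => iff_def.symm

theorem _root_.PrimrecPred.forall_mem_comp {f : α → List β} {p : α → β → Prop} (hf : Primrec f)
    (hp : PrimrecPred fun x : α × β => p x.1 x.2) : PrimrecPred fun a => ∀ b ∈ f a, p a b :=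
  (PrimrecRel.forall_mem_list (R := fun b a => p a b)
    (hp.comp (Primrec.pair Primrec.snd Primrec.fst))).comp hf Primrec.id

theorem _root_.PrimrecPred.forall_lt_comp {f : α → ℕ} {p : α → ℕ → Prop} (hf : Primrec f)
    (hp : PrimrecPred fun x : α × ℕ => p x.1 x.2) : PrimrecPred fun a => ∀ k < f a, p a k :=
  (PrimrecPred.forall_mem_comp (Primrec.list_range.comp hf) hp).of_eq fun a => by simp

theorem _root_.PrimrecPred.exists_mem_comp {f : α → List β} {p : α → β → Prop} (hf : Primrec f)
    (hp : PrimrecPred fun x : α × β => p x.1 x.2) : PrimrecPred fun a => ∃ b ∈ f a, p a b :=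
  (PrimrecRel.exists_mem_list (R := fun b a => p a b)
    (hp.comp (Primrec.pair Primrec.snd Primrec.fst))).comp hf Primrec.id

theorem primrec_filter_comp {f : α → List β} {p : α → β → Prop} [∀ a, DecidablePred (p a)]
    (hf : Primrec f) (hp : PrimrecPred fun x : α × β => p x.1 x.2) :
    Primrec fun a => (f a).filter (p a ·) := by
  have : Primrec fun a => (f a).flatMap fun b => if p a b then [b] else [] := by
    refine Primrec.list_flatMap hf ?_
    exact Primrec.ite hp (Primrec.list_cons.comp Primrec.snd (Primrec.const [])) (Primrec.const [])
  refine this.of_eq fun a => ?_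
  induction f a with
  | nil => rfl
  | cons b l ih => by_cases h : p a b <;> simp [h, ih]

theorem primrec_two_pow : Primrec fun n : ℕ => 2 ^ n :=
  Primrec₂.comp (f := fun a b : ℕ => a ^ b) (Primrec₂.unpaired'.1 Nat.Primrec.pow)
    (Primrec.const 2) Primrec.id

theorem _root_.PrimrecPred.mod_five_eq {f : α → ℕ} (hf : Primrec f) (i : ℕ) :
    PrimrecPred fun a => f a % 5 = i :=
  PrimrecRel.comp Primrec.eq (Primrec.nat_mod.comp hf (Primrec.const 5)) (Primrec.const i)

theorem _root_.Primrec.div_five {f : α → ℕ} (hf : Primrec f) : Primrec fun a => f a / 5 :=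
  Primrec.nat_div.comp hf (Primrec.const 5)

theorem _root_.PrimrecPred.testBit {f g : α → ℕ} (hf : Primrec f) (hg : Primrec g) :
    PrimrecPred fun a => ((f a).testBit (g a) : Prop) := by
  have : PrimrecPred fun a => f a / 2 ^ g a % 2 = 1 :=
    PrimrecRel.comp Primrec.eq
      (Primrec.nat_mod.comp (Primrec.nat_div.comp hf (primrec_two_pow.comp hg)) (Primrec.const 2))
      (Primrec.const 1)
  exact this.of_eq fun a => by simp [Nat.testBit_eq_decide_div_mod_eq]

theorem primrec_allSublists : Primrec allSublists := by
  refine Primrec.list_foldr (h := fun (_ : List ℕ) (p : ℕ × List (List ℕ)) => p.2 ++ p.2.map (List.cons p.1))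
    Primrec.id (Primrec.const [[]]) ?_
  have h2 : Primrec fun x : List ℕ × ℕ × List (List ℕ) => x.2.2 :=
    Primrec.snd.comp Primrec.snd
  refine Primrec.list_append.comp h2 (Primrec.list_map h2 ?_)
  exact Primrec.list_cons.comp (Primrec.fst.comp (Primrec.snd.comp Primrec.fst)) Primrec.snd

theorem _root_.PrimrecPred.sublist {f g : α → List ℕ} (hf : Primrec f) (hg : Primrec g) :
    PrimrecPred fun a => (f a).Sublist (g a) := by
  have : PrimrecPred fun a => ∃ w ∈ allSublists (g a), w = f a :=
    PrimrecPred.exists_mem_comp (primrec_allSublists.comp hg)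
      (PrimrecRel.comp Primrec.eq Primrec.snd (hf.comp Primrec.fst))
  exact this.of_eq fun a => by simp [mem_allSublists]

theorem _root_.PrimrecPred.sublistForall₂ {R : α → ℕ → ℕ → Prop}
    (hR : PrimrecPred fun x : α × ℕ × ℕ => R x.1 x.2.1 x.2.2) {f g : α → List ℕ}
    (hf : Primrec f) (hg : Primrec g) :
    PrimrecPred fun a => List.SublistForall₂ (R a) (f a) (g a) := by
  -- The matched sublist is found by bounded search and compared entry by entry; the default 0 is
  -- never read, since indices stay below the common length.
  have : PrimrecPred fun a => ∃ w ∈ allSublists (g a),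
      (f a).length = w.length ∧ ∀ i < (f a).length, R a ((f a).getD i 0) (w.getD i 0) := by
    refine PrimrecPred.exists_mem_comp (primrec_allSublists.comp hg) (.and ?_ ?_)
    · exact PrimrecRel.comp Primrec.eq (Primrec.list_length.comp (hf.comp Primrec.fst))
        (Primrec.list_length.comp Primrec.snd)
    · refine PrimrecPred.forall_lt_comp (Primrec.list_length.comp (hf.comp Primrec.fst))
        (hR.comp (Primrec.pair (Primrec.fst.comp Primrec.fst) (Primrec.pair ?_ ?_)))
      · exact (Primrec.list_getD 0).comp (hf.comp (Primrec.fst.comp Primrec.fst)) Primrec.snd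
      · exact (Primrec.list_getD 0).comp (Primrec.snd.comp Primrec.fst) Primrec.snd
  refine this.of_eq fun a => ?_
  simp only [mem_allSublists, List.sublistForall₂_iff, List.forall₂_iff_get]
  refine exists_congr fun w => ?_
  constructor
  · rintro ⟨h1, h2, h3⟩
    refine ⟨⟨h2, fun i hi hi' => ?_⟩, h1⟩
    have h := h3 i hi
    rwa [List.getD_eq_getElem _ _ hi, List.getD_eq_getElem _ _ hi'] at h
  · rintro ⟨⟨h2, h3⟩, h1⟩
    refine ⟨h1, h2, fun i hi => ?_⟩
    have hi' := h2 ▸ hi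
    rw [List.getD_eq_getElem _ _ hi, List.getD_eq_getElem _ _ hi']
    exact h3 i hi hi'

/-! ### Primitive recursiveness of the transition system and of its stopping test. -/

variable {n : α → ℕ}

theorem _root_.PrimrecPred.boolCoherent {t : α → ℕ} (hn : Primrec n) (ht : Primrec t) :
    PrimrecPred fun a => BoolCoherent (n a) (t a) := by
  have hk : Primrec fun x : α × ℕ => x.2 := Primrec.snd
  have ht' : Primrec fun x : α × ℕ => t x.1 := ht.comp Primrec.fst
  have hu := Primrec.unpair.comp (Primrec.div_five hk)
  refine PrimrecPred.forall_lt_comp (Primrec.succ.comp hn) (.and ?_ ?_)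
  · exact .imp (.mod_five_eq hk 1) (.iff (.testBit ht' hk) (.not (.testBit ht' (.div_five hk))))
  · exact .imp (.mod_five_eq hk 2) (.iff (.testBit ht' hk)
      (.and (.testBit ht' (Primrec.fst.comp hu)) (.testBit ht' (Primrec.snd.comp hu))))

theorem _root_.PrimrecPred.temporalStep {t s : α → ℕ} (hn : Primrec n) (ht : Primrec t)
    (hs : Primrec s) : PrimrecPred fun a => TemporalStep (n a) (t a) (s a) := by
  have hk : Primrec fun x : α × ℕ => x.2 := Primrec.snd
  have hs' : Primrec fun x : α × ℕ => s x.1 := hs.comp Primrec.fst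
  exact PrimrecPred.forall_lt_comp (Primrec.succ.comp hn) (.imp (.mod_five_eq hk 3)
    (.iff (.testBit (ht.comp Primrec.fst) hk)
      (.or (.testBit hs' (.div_five hk)) (.testBit hs' hk))))

theorem _root_.PrimrecPred.terminal {t : α → ℕ} (hn : Primrec n) (ht : Primrec t) :
    PrimrecPred fun a => Terminal (n a) (t a) :=
  PrimrecPred.forall_lt_comp (Primrec.succ.comp hn) (.imp (.mod_five_eq Primrec.snd 3)
    (.not (.testBit (ht.comp Primrec.fst) Primrec.snd)))

variable {e : α → List ℕ}

theorem _root_.PrimrecPred.final (hn : Primrec n) (he : Primrec e) :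
    PrimrecPred fun a => Final (n a) (e a) :=
  PrimrecPred.forall_mem_comp he (.terminal (hn.comp Primrec.fst) Primrec.snd)

theorem _root_.PrimrecPred.valid (hn : Primrec n) (he : Primrec e) :
    PrimrecPred fun a => Valid (n a) (e a) := by
  have hn' : Primrec fun x : α × ℕ => n x.1 := hn.comp Primrec.fst
  refine PrimrecPred.forall_mem_comp he (.and ?_ (.and ?_ ?_))
  · exact PrimrecRel.comp Primrec.nat_lt Primrec.snd
      (primrec_two_pow.comp (Primrec.succ.comp hn'))
  · exact .boolCoherent hn' Primrec.snd
  · have hτ : Primrec fun x : (α × ℕ) × ℕ => x.1.2 := Primrec.snd.comp Primrec.fst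
    refine PrimrecPred.forall_lt_comp (Primrec.succ.comp hn') (.imp (.mod_five_eq Primrec.snd 4)
      (.iff (.testBit hτ Primrec.snd) ?_))
    have he' : Primrec fun x : (α × ℕ) × ℕ => e x.1.1 :=
      he.comp (Primrec.fst.comp Primrec.fst)
    have hτ' : Primrec fun x : ((α × ℕ) × ℕ) × ℕ => x.1.1.2 := hτ.comp Primrec.fst
    refine PrimrecPred.exists_mem_comp he' (.and ?_ (.or ?_ ?_))
    · exact .testBit Primrec.snd (.div_five (Primrec.snd.comp Primrec.fst))
    · exact (PrimrecRel.comp Primrec.eq Primrec.snd hτ').not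
    · exact .sublist (Primrec.list_cons.comp hτ' (Primrec.list_cons.comp hτ' (Primrec.const [])))
        (he'.comp Primrec.fst)

theorem _root_.PrimrecPred.initial (hn : Primrec n) (he : Primrec e) :
    PrimrecPred fun a => Initial (n a) (e a) :=
  .and (.valid hn he)
    (PrimrecPred.exists_mem_comp he (.testBit Primrec.snd (hn.comp Primrec.fst)))

theorem _root_.PrimrecPred.next {d : α → List ℕ} (hn : Primrec n) (hd : Primrec d) (he : Primrec e) :
    PrimrecPred fun a => Next (n a) (d a) (e a) :=
  .and (.valid hn he) (.sublistForall₂ (R := fun a => TemporalStep (n a))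
    (.temporalStep (hn.comp Primrec.fst) (Primrec.fst.comp Primrec.snd)
      (Primrec.snd.comp Primrec.snd)) hd he)

theorem primrec₂_candidates : Primrec₂ candidates := by
  refine primrec_allSublists.comp (Primrec.list_flatMap (Primrec.list_range.comp Primrec.snd) ?_)
  exact Primrec.list_range.comp (primrec_two_pow.comp
    (Primrec.succ.comp (Primrec.fst.comp Primrec.fst)))

theorem primrec_initials : Primrec initials := by
  classical
  refine primrec_filter_comp (primrec₂_candidates.comp Primrec.id ?_)
    (.initial Primrec.fst Primrec.snd)
  exact Primrec.nat_add.comp (Primrec.const 1) (Primrec.nat_mul.comp (Primrec.const 2)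
    (primrec_two_pow.comp Primrec.succ))

theorem primrec₂_nexts : Primrec₂ nexts := by
  classical
  refine primrec_filter_comp (f := fun x : ℕ × List ℕ =>
    candidates x.1 (x.2.length + 2 * 2 ^ (x.1 + 1))) (primrec₂_candidates.comp Primrec.fst ?_)
    (.next (Primrec.fst.comp Primrec.fst) (Primrec.snd.comp Primrec.fst) Primrec.snd)
  exact Primrec.nat_add.comp (Primrec.list_length.comp Primrec.snd)
    (Primrec.nat_mul.comp (Primrec.const 2)
      (primrec_two_pow.comp (Primrec.succ.comp Primrec.fst)))

theorem primrec₂_reach : Primrec₂ reach := by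
  refine Primrec.nat_rec (g := fun N p => p.2 ++ p.2.flatMap (nexts N)) primrec_initials ?_
  have hR : Primrec fun x : ℕ × ℕ × List (List ℕ) => x.2.2 := Primrec.snd.comp Primrec.snd
  exact Primrec.list_append.comp hR (Primrec.list_flatMap hR
    (primrec₂_nexts.comp (Primrec.fst.comp Primrec.fst) Primrec.snd))

theorem primrecPred_stable : PrimrecPred fun p : ℕ × ℕ => Stable p.1 p.2 := by
  refine PrimrecPred.forall_mem_comp
    (primrec₂_reach.comp Primrec.fst (Primrec.succ.comp Primrec.snd)) ?_
  refine PrimrecPred.exists_mem_comp (primrec₂_reach.comp (Primrec.fst.comp Primrec.fst)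
    (Primrec.snd.comp Primrec.fst)) ?_
  exact .sublist Primrec.snd (Primrec.snd.comp Primrec.fst)

theorem computablePred_exists_reachable_final :
    ComputablePred fun N => ∃ e, Reachable N e ∧ Final N e := by
  classical
  have hfind : Computable fun N => Nat.find (exists_stable N) :=
    Computable.find primrecPred_stable.computablePred exists_stable
  have hfin : PrimrecPred fun p : ℕ × ℕ => ∃ e ∈ reach p.1 p.2, Final p.1 e :=
    PrimrecPred.exists_mem_comp primrec₂_reach
      (PrimrecPred.final (Primrec.fst.comp Primrec.fst) Primrec.snd)
  have hcomp := (PrimrecPred.decide hfin).to_comp.comp (Computable.pair Computable.id hfind)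
  refine ComputablePred.of_eq (Computable.computablePred
    (p := fun N => ∃ e ∈ reach N (Nat.find (exists_stable N)), Final N e) ?_) fun N =>
      (Nat.find_spec (exists_stable N)).exists_final_iff.symm
  exact hcomp

end Primrec

/-! ### A common form of the two semantics -/

/-- Truth of `φ` at the moment `x` for the element `a`, where `D x` is the domain of `x`. -/
def Holds {W A : Type*} (R : W → W → Prop) (D : W → Set A) (V : ℕ → W → A → Prop) :
    Formula → W → A → Prop
  | .var n, x, a => V n x a
  | .neg φ, x, a => ¬ Holds R D V φ x a
  | .and φ ψ, x, a => Holds R D V φ x a ∧ Holds R D V ψ x a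
  | .dia0 φ, x, a => ∃ y, R x y ∧ a ∈ D y ∧ Holds R D V φ y a
  | .dia1 φ, x, a => ∃ b ∈ D x, b ≠ a ∧ Holds R D V φ x b

/-- `φ` holds somewhere over a finite linear order with expanding domains. -/
def HoldsSomewhere (φ : Formula) : Prop :=
  ∃ F ∈ finiteLinearFrames.{u}, ∃ (A : Type u) (D : F.World → Set A)
    (V : ℕ → F.World → A → Prop), (∀ x, (D x).Nonempty) ∧ (∀ x y, F.Rel x y → D x ⊆ D y) ∧
      ∃ x, ∃ a ∈ D x, Holds F.Rel D V φ x a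

/-- `Holds` lives on the ambient type and guards its diamonds by domain membership, so values
outside the domains are harmless. The vertical relation is inequality only within each domain, which
is all that is used. -/
theorem truth_twoFrame_iff_holds {F : Frame.{u}} (G : VerticalFrames F)
    (hG : ∀ x, G.frame x ∈ differenceFrames) {ν : ℕ → Set G.twoFrame.World}
    {V : ℕ → F.World → G.Ambient → Prop}
    (hV : ∀ n (x : F.World) (a : G.Ambient) (h : a ∈ G.dom x),
      (⟨(x, a), h⟩ : {p : F.World × G.Ambient // p.2 ∈ G.dom p.1}) ∈ ν n ↔ V n x a)
    (φ : Formula) (x : F.World) (a : G.Ambient) (h : a ∈ G.dom x) :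
    Truth G.twoFrame ν φ ⟨(x, a), h⟩ ↔ Holds F.Rel G.dom V φ x a := by
  induction φ generalizing x a with
  | var n => exact hV n x a h
  | neg φ ih => exact not_congr (ih x a h)
  | and φ ψ ih1 ih2 => exact and_congr (ih1 x a h) (ih2 x a h)
  | dia0 φ ih =>
    constructor
    · rintro ⟨⟨⟨y, b⟩, hb⟩, ⟨hxy, hab⟩, ht⟩
      obtain rfl : a = b := hab
      exact ⟨y, hxy, hb, (ih y a hb).1 ht⟩
    · rintro ⟨y, hxy, hb, ht⟩
      exact ⟨⟨(y, a), hb⟩, ⟨hxy, rfl⟩, (ih y a hb).2 ht⟩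
  | dia1 φ ih =>
    have hrel : ∀ b (hb : b ∈ G.dom x), G.rel x a b ↔ a ≠ b := fun b hb =>
      (hG x ⟨a, h⟩ ⟨b, hb⟩).trans (not_congr Subtype.mk_eq_mk)
    constructor
    · rintro ⟨⟨⟨y, b⟩, hb⟩, ⟨hab, hxy⟩, ht⟩
      obtain rfl : x = y := hxy
      exact ⟨b, hb, ((hrel b hb).1 hab).symm, (ih x b hb).1 ht⟩
    · rintro ⟨b, hb, hba, ht⟩
      exact ⟨⟨(x, b), hb⟩, ⟨(hrel b hb).2 hba.symm, rfl⟩, (ih x b hb).2 ht⟩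

theorem satisfiable_iff_holdsSomewhere (φ : Formula) :
    Satisfiable.{u} (expandingProduct finiteLinearFrames differenceFrames) φ ↔
      HoldsSomewhere.{u} φ := by
  constructor
  · rintro ⟨K, ⟨F, G, hF, hG, hexp, rfl⟩, ν, ⟨⟨x, a⟩, h⟩, ht⟩
    refine ⟨F, hF, G.Ambient, G.dom, fun n x a => ∃ h : a ∈ G.dom x,
      (⟨(x, a), h⟩ : {p : F.World × G.Ambient // p.2 ∈ G.dom p.1}) ∈ ν n, G.dom_nonempty,
      fun x y hxy => (hexp x y hxy).1, x, a, h, ?_⟩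
    refine (truth_twoFrame_iff_holds G hG (fun n x a h => ?_) φ x a h).1 ht
    exact ⟨fun h' => ⟨h, h'⟩, fun ⟨_, h'⟩ => h'⟩
  · rintro ⟨F, hF, A, D, V, hne, hexp, x, a, h, ht⟩
    let G : VerticalFrames F := ⟨A, D, hne, fun _ a b => a ≠ b⟩
    have hG : ∀ x, G.frame x ∈ differenceFrames := fun x a b => not_congr Subtype.ext_iff.symm
    exact ⟨G.twoFrame, ⟨F, G, hF, hG, fun x y hxy => ⟨hexp x y hxy, fun _ _ _ _ => Iff.rfl⟩, rfl⟩,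
      fun n => {p | V n p.1.1 p.1.2}, ⟨(x, a), h⟩,
      (truth_twoFrame_iff_holds G hG (fun _ _ _ _ => Iff.rfl) φ x a h).2 ht⟩

theorem foTruth_iff_holds {F : Frame.{u}} (M : FOModel F) {V : ℕ → F.World → M.Obj → Prop}
    (hV : ∀ n t (a : M.dom t), a ∈ M.I t n ↔ V n t a) (φ : FOFormula) (t : F.World)
    (a : M.dom t) : M.Truth φ t a ↔ Holds F.Rel M.dom V φ.star t a := by
  induction φ generalizing t a with
  | pred n => exact hV n t a
  | neg φ ih => exact not_congr (ih t a)
  | and φ ψ ih1 ih2 => exact and_congr (ih1 t a) (ih2 t a)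
  | eventually φ ih =>
    refine exists_congr fun t' => and_congr_right fun _ => ?_
    exact ⟨fun ⟨h, ht⟩ => ⟨h, (ih t' _).1 ht⟩, fun ⟨h, ht⟩ => ⟨h, (ih t' ⟨a, h⟩).2 ht⟩⟩
  | exNe φ ih =>
    constructor
    · rintro ⟨b, hb, ht⟩
      exact ⟨b, b.2, fun h => hb (Subtype.ext h), (ih t b).1 ht⟩
    · rintro ⟨b, hb, hne, ht⟩
      exact ⟨⟨b, hb⟩, fun h => hne (congrArg Subtype.val h), (ih t ⟨b, hb⟩).2 ht⟩

theorem foSatisfiableExpanding_iff_holdsSomewhere (φ : FOFormula) :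
    FOSatisfiableExpanding.{u} finiteLinearFrames φ ↔ HoldsSomewhere.{u} φ.star := by
  constructor
  · rintro ⟨F, hF, M, hexp, t, a, ht⟩
    refine ⟨F, hF, M.Obj, M.dom, fun n t a => ∃ h : a ∈ M.dom t, ⟨a, h⟩ ∈ M.I t n,
      M.dom_nonempty, hexp, t, a, a.2, ?_⟩
    exact (foTruth_iff_holds M (fun n t a => ⟨fun h => ⟨a.2, h⟩, fun ⟨_, h⟩ => h⟩) φ t a).1 ht
  · rintro ⟨F, hF, A, D, V, hne, hexp, x, a, h, ht⟩
    let M : FOModel F := ⟨A, D, hne, fun t n => {a | V n t a}⟩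
    exact ⟨F, hF, M, hexp, x, ⟨a, h⟩,
      (foTruth_iff_holds M (fun _ _ _ => Iff.rfl) φ x ⟨a, h⟩).2 ht⟩

/-! ### Truth of a formula in terms of its Gödel number. -/

section Codes

variable {W A : Type*} {R : W → W → Prop} {D : W → Set A} {V : ℕ → W → A → Prop} {k : ℕ}

theorem holds_ofNat_var (h : k % 5 = 0) (x : W) (a : A) :
    Holds R D V (.ofNat k) x a ↔ V (k / 5) x a := by
  rw [Formula.ofNat]; simp [h, Holds]

theorem holds_ofNat_neg (h : k % 5 = 1) (x : W) (a : A) :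
    Holds R D V (.ofNat k) x a ↔ ¬ Holds R D V (.ofNat (k / 5)) x a := by
  rw [Formula.ofNat]; simp [h, Holds]

theorem holds_ofNat_and (h : k % 5 = 2) (x : W) (a : A) :
    Holds R D V (.ofNat k) x a ↔ Holds R D V (.ofNat (k / 5).unpair.1) x a ∧
      Holds R D V (.ofNat (k / 5).unpair.2) x a := by
  rw [Formula.ofNat]; simp [h, Holds]

theorem holds_ofNat_dia0 (h : k % 5 = 3) (x : W) (a : A) :
    Holds R D V (.ofNat k) x a ↔ ∃ y, R x y ∧ a ∈ D y ∧ Holds R D V (.ofNat (k / 5)) y a := by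
  rw [Formula.ofNat]; simp [h, Holds]

theorem holds_ofNat_dia1 (h : k % 5 = 4) (x : W) (a : A) :
    Holds R D V (.ofNat k) x a ↔ ∃ b ∈ D x, b ≠ a ∧ Holds R D V (.ofNat (k / 5)) x b := by
  rw [Formula.ofNat]; simp [h, Holds]

end Codes

/-! ### Multiplicities in lists of types -/

theorem exists_pair_sublist {α : Type*} {l : List α} {a b : α} (ha : a ∈ l) (hb : b ∈ l)
    (hab : a ≠ b) : [a, b].Sublist l ∨ [b, a].Sublist l := by
  induction l with
  | nil => simp at ha
  | cons c l ih =>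
    rcases List.mem_cons.1 ha with rfl | ha'
    · exact .inl ((List.singleton_sublist.2 (List.mem_of_ne_of_mem hab.symm hb)).cons_cons a)
    rcases List.mem_cons.1 hb with rfl | hb'
    · exact .inr ((List.singleton_sublist.2 ha').cons_cons b)
    · exact (ih ha' hb').imp (·.cons c) (·.cons c)

/-- Some other element of a list has a type satisfying `P`, expressed by the list of types. -/
theorem exists_mem_map_iff_exists_ne {α : Type*} {l : List α} (hl : l.Nodup) (f : α → ℕ)
    (P : ℕ → Prop) {a : α} (ha : a ∈ l) :
    (∃ σ ∈ l.map f, P σ ∧ (σ ≠ f a ∨ [f a, f a].Sublist (l.map f))) ↔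
      ∃ b ∈ l, b ≠ a ∧ P (f b) := by
  constructor
  · rintro ⟨σ, hσ, hP, h⟩
    obtain ⟨b, hb, rfl⟩ := List.mem_map.1 hσ
    by_cases hba : b = a
    · subst hba
      -- A repeated type comes from two distinct elements `c` and `d`, and at least one of them
      -- differs from `b`.
      obtain ⟨l', hl', hm⟩ := List.sublist_map_iff.1 (h.resolve_left (not_not.2 rfl))
      obtain ⟨c, d, rfl⟩ := List.length_eq_two.1 (by simpa using (congrArg List.length hm).symm)
      have hcd : c ≠ d := by simpa using hl.sublist hl'
      simp only [List.map_cons, List.map_nil, List.cons.injEq, and_true] at hm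
      by_cases hc : c = b
      · exact ⟨d, hl'.subset (by simp), fun h => hcd (hc.trans h.symm), hm.2 ▸ hP⟩
      · exact ⟨c, hl'.subset (by simp), hc, hm.1 ▸ hP⟩
    · exact ⟨b, hb, hba, hP⟩
  · rintro ⟨b, hb, hba, hP⟩
    refine ⟨f b, List.mem_map_of_mem hb, hP, or_iff_not_imp_left.2 fun h => ?_⟩
    have hf : f b = f a := not_not.1 h
    rcases exists_pair_sublist hb ha hba with h | h
    · simpa [hf] using h.map f
    · simpa [hf] using h.map f

/-! ### From models to runs -/

/-- Two elements of a set suffice to provide an element different from any given one. -/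
theorem exists_finset_ne {α : Type*} (S : Set α) :
    ∃ s : Finset α, ↑s ⊆ S ∧ ∀ a, (∃ b ∈ S, b ≠ a) → ∃ b ∈ s, b ≠ a := by
  classical
  by_cases h : ∃ c ∈ S, ∃ d ∈ S, c ≠ d
  · obtain ⟨c, hc, d, hd, hcd⟩ := h
    refine ⟨{c, d}, by simp [Set.insert_subset_iff, hc, hd], fun a _ => ?_⟩
    by_cases hca : c = a
    · exact ⟨d, by simp, fun h => hcd (hca.trans h.symm)⟩
    · exact ⟨c, by simp, hca⟩
  · push Not at h
    by_cases hS : S.Nonempty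
    · obtain ⟨c, hc⟩ := hS
      refine ⟨{c}, by simpa using hc, fun a ⟨b, hb, hba⟩ => ⟨c, by simp, ?_⟩⟩
      rwa [h c hc b hb]
    · exact ⟨∅, by simp, fun a ⟨b, hb, _⟩ => absurd ⟨b, hb⟩ hS⟩

section Run

variable {W A : Type*} (R : W → W → Prop) (D : W → Set A) (V : ℕ → W → A → Prop) (N : ℕ)

open Classical in
/-- The type of `a` at `x`. -/
noncomputable def typeOf (x : W) (a : A) : ℕ :=
  Nat.ofBits fun i : Fin (N + 1) => decide (Holds R D V (.ofNat i) x a)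

variable {R D V N}

theorem testBit_typeOf {k : ℕ} (hk : k < N + 1) (x : W) (a : A) :
    (typeOf R D V N x a).testBit k ↔ Holds R D V (.ofNat k) x a := by
  simp [typeOf, Nat.testBit_ofBits_lt _ _ hk]

theorem boolCoherent_typeOf (x : W) (a : A) : BoolCoherent N (typeOf R D V N x a) := by
  intro k hk
  have h1 := Nat.unpair_left_le (k / 5)
  have h2 := Nat.unpair_right_le (k / 5)
  rw [testBit_typeOf hk, testBit_typeOf (by omega), testBit_typeOf (by omega),
    testBit_typeOf (by omega)]
  exact ⟨fun h => holds_ofNat_neg h x a, fun h => holds_ofNat_and h x a⟩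

/-- Types are computed in the whole domain but listed only for `l`; `hw` says that `l` contains
enough witnesses for difference diamonds not to notice. -/
theorem valid_map_typeOf {x : W} {l : List A} (hl : l.Nodup) (hD : ∀ a ∈ l, a ∈ D x)
    (hw : ∀ k < N + 1, ∀ a ∈ l, (∃ b ∈ D x, b ≠ a ∧ Holds R D V (.ofNat k) x b) →
      ∃ b ∈ l, b ≠ a ∧ Holds R D V (.ofNat k) x b) : Valid N (l.map (typeOf R D V N x)) := by
  intro τ hτ
  obtain ⟨a, ha, rfl⟩ := List.mem_map.1 hτ
  refine ⟨Nat.ofBits_lt_two_pow _, boolCoherent_typeOf x a, fun k hk hk4 => ?_⟩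
  rw [exists_mem_map_iff_exists_ne hl _ (fun σ => σ.testBit (k / 5)) ha, testBit_typeOf hk,
    holds_ofNat_dia1 hk4]
  have hk' : k / 5 < N + 1 := by omega
  simp only [testBit_typeOf hk']
  exact ⟨hw _ hk' a ha, fun ⟨b, hb, h⟩ => ⟨b, hD b hb, h⟩⟩

/-- Here `y` is the immediate successor of `x`, so "later than `x`" means "at `y` or later than
`y`". -/
theorem temporalStep_typeOf {x y : W} (htrans : ∀ z, R y z → R x z) (hxy : R x y)
    (hcov : ∀ z, R x z → z = y ∨ R y z) {a : A} (ha : a ∈ D y) :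
    TemporalStep N (typeOf R D V N x a) (typeOf R D V N y a) := by
  intro k hk hk3
  rw [testBit_typeOf hk, testBit_typeOf hk, testBit_typeOf (by omega), holds_ofNat_dia0 hk3,
    holds_ofNat_dia0 hk3]
  constructor
  · rintro ⟨z, hxz, haz, h⟩
    rcases hcov z hxz with rfl | hyz
    · exact .inl h
    · exact .inr ⟨z, hyz, haz, h⟩
  · rintro (h | ⟨z, hyz, haz, h⟩)
    · exact ⟨y, hxy, ha, h⟩
    · exact ⟨z, htrans z hyz, haz, h⟩

theorem terminal_typeOf {x : W} (hx : ∀ y, ¬ R x y) (a : A) :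
    Terminal N (typeOf R D V N x a) := by
  intro k hk hk3
  rw [testBit_typeOf hk, holds_ofNat_dia0 hk3]
  rintro ⟨y, hxy, -⟩
  exact hx y hxy

end Run

theorem HoldsSomewhere.exists_reachable_final {φ : Formula} (h : HoldsSomewhere.{u} φ) :
    ∃ e, Reachable φ.toNat e ∧ Final φ.toNat e := by
  classical
  obtain ⟨F, ⟨⟨hirr, htrans, htot⟩, hfin⟩, A, D, V, -, hexp, x₀, a₀, ha₀, hφ⟩ := h
  set N := φ.toNat with hN
  choose s hsub hs using fun p : F.World × Fin (N + 1) =>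
    exists_finset_ne {b | b ∈ D p.1 ∧ Holds F.Rel D V (.ofNat p.2) p.1 b}
  have := Fintype.ofFinite F.World
  -- One finite pool for all moments: the evaluation point and the witnesses for every moment and
  -- every code up to `N`.
  let S : Finset A := insert a₀ (Finset.univ.biUnion s)
  let l : F.World → List A := fun x => S.toList.filter (· ∈ D x)
  have hmem : ∀ x a, a ∈ l x ↔ a ∈ S ∧ a ∈ D x := by simp [l]
  let e : F.World → List ℕ := fun x => (l x).map (typeOf F.Rel D V N x)
  have hvalid : ∀ x, Valid N (e x) := by
    intro x
    refine valid_map_typeOf (S.nodup_toList.filter _) (fun a ha => ((hmem x a).1 ha).2) ?_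
    rintro k hk a - ⟨b, hb, hba, h⟩
    obtain ⟨c, hc, hca⟩ := hs (x, ⟨k, hk⟩) a ⟨b, ⟨hb, h⟩, hba⟩
    have hc' := hsub (x, ⟨k, hk⟩) hc
    refine ⟨c, (hmem x c).2 ⟨?_, hc'.1⟩, hca, hc'.2⟩
    exact Finset.mem_insert_of_mem (Finset.mem_biUnion.2 ⟨_, Finset.mem_univ _, hc⟩)
  have : IsTrans F.World F.Rel := ⟨htrans⟩
  have : Std.Irrefl F.Rel := ⟨hirr⟩
  have : IsTrans F.World (Function.swap F.Rel) := ⟨fun x y z h1 h2 => htrans z y x h2 h1⟩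
  have : Std.Irrefl (Function.swap F.Rel) := ⟨hirr⟩
  have hwf : WellFounded F.Rel := Finite.wellFounded_of_trans_of_irrefl _
  have hwf' : WellFounded (Function.swap F.Rel) := Finite.wellFounded_of_trans_of_irrefl _
  have hrun : ∀ x, Reachable N (e x) → ∃ e, Reachable N e ∧ Final N e := by
    intro x
    induction x using hwf'.induction with
    | _ x ih =>
      intro hx
      by_cases hmax : ∃ y, F.Rel x y
      -- The least later moment is the immediate successor; the outer induction runs towards the
      -- last moment.
      · obtain ⟨y, hxy, hmin⟩ := hwf.has_min {y | F.Rel x y} hmax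
        refine ih y hxy (hx.step ⟨hvalid y, ?_⟩)
        rw [List.sublistForall₂_map_left_iff, List.sublistForall₂_map_right_iff,
          List.sublistForall₂_iff]
        -- Both lists filter the same enumeration of `S` and domains grow, so `l x` is a sublist of
        -- `l y` and each element is matched with itself.
        refine ⟨l x, List.forall₂_same.2 fun a ha => ?_, ?_⟩
        · refine temporalStep_typeOf (fun z => htrans x y z hxy) hxy (fun z hz => ?_)
            (hexp x y hxy ((hmem x a).1 ha).2)
          rcases htot z y with h | h | h
          · exact absurd h (hmin z hz)
          · exact .inl h
          · exact .inr h
        · exact List.monotone_filter_right _ fun a ha => by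
            simpa using hexp x y hxy (by simpa using ha)
      · refine ⟨e x, hx, fun τ hτ => ?_⟩
        obtain ⟨a, -, rfl⟩ := List.mem_map.1 hτ
        exact terminal_typeOf (by simpa using hmax) a
  refine hrun x₀ (.init ⟨hvalid x₀, _, List.mem_map_of_mem
    ((hmem x₀ a₀).2 ⟨Finset.mem_insert_self _ _, ha₀⟩), ?_⟩)
  rw [testBit_typeOf (by omega), hN, Formula.ofNat_toNat]
  exact hφ

/-! ### From runs to models -/

/-- The configuration `d` starts a run whose elements are identified over time: `l t` lists the
elements existing at `t`, and `ty t a` is the type of `a` at `t`. -/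
def StartsRun (N : ℕ) (d : List ℕ) : Prop :=
  ∃ (n : ℕ) (l : ℕ → List ℕ) (ty : ℕ → ℕ → ℕ),
    (∀ t ≤ n, (l t).Nodup ∧ Valid N ((l t).map (ty t))) ∧
    (∀ t < n, (l t).Sublist (l (t + 1)) ∧ ∀ a ∈ l t, TemporalStep N (ty t a) (ty (t + 1) a)) ∧
    (∀ a ∈ l n, Terminal N (ty n a)) ∧ (l 0).map (ty 0) = d

theorem exists_map_eq {l : List ℕ} (hl : l.Nodup) {d : List ℕ} (h : d.length = l.length) :
    ∃ f : ℕ → ℕ, l.map f = d := by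
  refine ⟨fun a => d.getD (l.idxOf a) 0, List.ext_getElem (by simpa using h.symm) ?_⟩
  intro i h1 h2
  simp [hl.idxOf_getElem, h2]

theorem Final.startsRun {N : ℕ} {d : List ℕ} (hf : Final N d) (hd : Valid N d) :
    StartsRun N d := by
  obtain ⟨f, hm⟩ := exists_map_eq (List.nodup_range (n := d.length)) (d := d) (by simp)
  refine ⟨0, fun _ => List.range d.length, fun _ => f, fun _ _ => ⟨List.nodup_range, hm.symm ▸ hd⟩,
    by simp, fun a ha => hf _ ?_, hm⟩
  rw [← hm]
  exact List.mem_map_of_mem ha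

/-- Runs are built backwards: the elements of `e` already have names, and those of `d` inherit the
names of their partners. Persistence then becomes literal inclusion of name lists. -/
theorem Next.startsRun {N : ℕ} {d e : List ℕ} (h : Next N d e) (hd : Valid N d)
    (he : StartsRun N e) : StartsRun N d := by
  obtain ⟨n, l, ty, h1, h2, h3, rfl⟩ := he
  obtain ⟨w, hw, hwe⟩ := List.sublistForall₂_iff.1 h.2
  obtain ⟨l', hl', rfl⟩ := List.sublist_map_iff.1 hwe
  have hnd : l'.Nodup := (h1 0 (Nat.zero_le n)).1.sublist hl'
  obtain ⟨f, rfl⟩ := exists_map_eq hnd (d := d) (by simpa using hw.length_eq)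
  rw [List.forall₂_map_left_iff, List.forall₂_map_right_iff, List.forall₂_same] at hw
  -- The new moment becomes time 0 and the old run is shifted by one.
  refine ⟨n + 1, fun t => t.casesOn l' l, fun t => t.casesOn f ty, ?_, ?_, h3, rfl⟩
  · rintro (_ | t) ht
    · exact ⟨hnd, hd⟩
    · exact h1 t (by omega)
  · rintro (_ | t) ht
    · exact ⟨hl', hw⟩
    · exact h2 t (by omega)

theorem Reachable.exists_initial_startsRun {N : ℕ} {e : List ℕ} (h : Reachable N e)
    (he : StartsRun N e) : ∃ d, Initial N d ∧ StartsRun N d := by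
  induction h with
  | init h => exact ⟨_, h, he⟩
  | step hd hstep ih => exact ih (hstep.startsRun hd.valid he)

/-- Backward induction from the last moment: the local step condition unwinds to the global meaning
of "eventually", and terminality prevents a diamond from being postponed forever. -/
theorem exists_later_iff_testBit {N n : ℕ} {l : ℕ → List ℕ} {ty : ℕ → ℕ → ℕ}
    (hstep : ∀ t < n, (l t).Sublist (l (t + 1)) ∧
      ∀ a ∈ l t, TemporalStep N (ty t a) (ty (t + 1) a))
    (hlast : ∀ a ∈ l n, Terminal N (ty n a)) {k : ℕ} (hk : k < N + 1) (hk3 : k % 5 = 3) {a t : ℕ}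
    (ht : t ≤ n) (ha : a ∈ l t) :
    (ty t a).testBit k ↔ ∃ s, t < s ∧ s ≤ n ∧ (ty s a).testBit (k / 5) := by
  induction ht using Nat.decreasingInduction with
  | self =>
    refine iff_of_false (hlast a ha k hk hk3) ?_
    rintro ⟨s, h1, h2, -⟩
    omega
  | of_succ t ht ih =>
    rw [(hstep t ht).2 a ha k hk hk3, ih ((hstep t ht).1.subset ha)]
    constructor
    · rintro (h | ⟨s, h1, h2, h3⟩)
      · exact ⟨t + 1, by omega, ht, h⟩
      · exact ⟨s, by omega, h2, h3⟩
    · rintro ⟨s, h1, h2, h3⟩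
      rcases Nat.eq_or_lt_of_le (Nat.succ_le_of_lt h1) with rfl | h
      · exact .inl h3
      · exact .inr ⟨s, h, h2, h3⟩

theorem StartsRun.holdsSomewhere {φ : Formula} {d : List ℕ} (h : StartsRun φ.toNat d)
    (hd : Initial φ.toNat d) : HoldsSomewhere.{u} φ := by
  obtain ⟨n, l, ty, hval, hstep, hlast, rfl⟩ := h
  obtain ⟨-, τ, hτ, hbit⟩ := hd
  obtain ⟨a₀, ha₀, rfl⟩ := List.mem_map.1 hτ
  set N := φ.toNat with hN
  have hmono : ∀ s t, s ≤ t → t ≤ n → l s ⊆ l t := by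
    intro s t hst
    induction hst with
    | refl => exact fun _ _ h => h
    | step _ ih => exact fun ht a ha => (hstep _ ht).1.subset (ih (by omega) ha)
  let F : Frame.{u} :=
    ⟨ULift (Fin (n + 1)), ⟨⟨0⟩⟩, fun s t => s.down < t.down⟩
  have hF : F ∈ finiteLinearFrames := by
    refine ⟨⟨fun x => lt_irrefl x.down, fun x y z => lt_trans (a := x.down), fun x y => ?_⟩,
      inferInstanceAs (Finite (ULift (Fin (n + 1))))⟩
    rcases lt_trichotomy x.down y.down with h | h | h
    · exact .inl h
    · exact .inr (.inl (ULift.down_injective h))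
    · exact .inr (.inr h)
  let D : F.World → Set (ULift.{u} ℕ) := fun t => {a | a.down ∈ l t.down}
  -- `5 * m` is the code of variable `m`; variables with codes above `N` do not occur in the
  -- formula.
  let V : ℕ → F.World → ULift.{u} ℕ → Prop := fun m t a => (ty t.down a.down).testBit (5 * m)
  have hle : ∀ t : F.World, (t.down : ℕ) ≤ n := fun t => Nat.lt_succ_iff.1 t.down.2
  -- Truth lemma, by strong induction on codes, with the outermost connective read off from the
  -- residue modulo 5.
  have key : ∀ k < N + 1, ∀ (t : F.World) (a : ULift.{u} ℕ), a ∈ D t →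
      (Holds F.Rel D V (.ofNat k) t a ↔ (ty t.down a.down).testBit k) := by
    intro k
    induction k using Nat.strong_induction_on with
    | _ k ih =>
      intro hk t a ha
      have hl := Nat.unpair_left_le (k / 5)
      have hr := Nat.unpair_right_le (k / 5)
      obtain ⟨hnd, hv⟩ := hval t.down (hle t)
      obtain ⟨-, hbool, hdia⟩ := hv _ (List.mem_map_of_mem ha)
      have hk5 : k % 5 < 5 := Nat.mod_lt _ (by norm_num)
      interval_cases hm : k % 5
      · rw [holds_ofNat_var hm, show k = 5 * (k / 5) by omega]
        simp [V]
      · rw [holds_ofNat_neg hm, ih (k / 5) (by omega) (by omega) t a ha, (hbool k hk).1 hm]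
      · rw [holds_ofNat_and hm, ih _ (by omega) (by omega) t a ha,
          ih _ (by omega) (by omega) t a ha, (hbool k hk).2 hm]
      · rw [holds_ofNat_dia0 hm, exists_later_iff_testBit hstep hlast hk hm (hle t) ha]
        constructor
        · rintro ⟨s, hts, has, h⟩
          exact ⟨s.down, hts, hle s, (ih _ (by omega) (by omega) s a has).1 h⟩
        · rintro ⟨s, hts, hsn, h⟩
          have has : a ∈ D ⟨⟨s, by omega⟩⟩ := hmono _ s hts.le hsn ha
          exact ⟨⟨⟨s, by omega⟩⟩, hts, has, (ih _ (by omega) (by omega) _ a has).2 h⟩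
      · rw [holds_ofNat_dia1 hm, hdia k hk hm,
          exists_mem_map_iff_exists_ne hnd (ty t.down) (fun σ => σ.testBit (k / 5)) ha]
        constructor
        · rintro ⟨b, hb, hba, h⟩
          exact ⟨b.down, hb, fun h => hba (ULift.down_injective h),
            (ih _ (by omega) (by omega) t b hb).1 h⟩
        · rintro ⟨b, hb, hba, h⟩
          exact ⟨⟨b⟩, hb, fun h => hba (congrArg ULift.down h),
            (ih _ (by omega) (by omega) t ⟨b⟩ hb).2 h⟩
  refine ⟨F, hF, ULift.{u} ℕ, D, V, fun t => ⟨⟨a₀⟩, hmono 0 _ (Nat.zero_le _) (hle t) ha₀⟩,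
    fun s t hst a ha => hmono _ _ (le_of_lt hst) (hle t) ha, ⟨0⟩, ⟨a₀⟩, ha₀, ?_⟩
  have := (key N (by omega) ⟨0⟩ ⟨a₀⟩ ha₀).2 hbit
  rwa [hN, Formula.ofNat_toNat] at this

theorem holdsSomewhere_iff (φ : Formula) :
    HoldsSomewhere.{u} φ ↔ ∃ e, Reachable φ.toNat e ∧ Final φ.toNat e := by
  refine ⟨fun h => h.exists_reachable_final, fun ⟨e, he, hf⟩ => ?_⟩
  obtain ⟨d, hd, hrun⟩ := he.exists_initial_startsRun (hf.startsRun he.valid)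
  exact hrun.holdsSomewhere hd

end BimodalLogic

/-- Satisfiability over expanding 2-frames with finite linear orders as horizontal components and
difference frames as vertical components is decidable, and FOLTL≠-satisfiability in expanding
domain models over the class of all finite linear orders is decidable. -/
theorem theorem9 :
    ComputablePred (BimodalLogic.Satisfiable.{u}
      (BimodalLogic.expandingProduct
        BimodalLogic.finiteLinearFrames BimodalLogic.differenceFrames)) ∧
    ComputablePred
      (BimodalLogic.FOSatisfiableExpanding.{u} BimodalLogic.finiteLinearFrames) := by
  constructor
  · refine ComputablePred.computable_of_manyOneReducible ⟨Encodable.encode,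
      Computable.encode, fun φ => ?_⟩ BimodalLogic.computablePred_exists_reachable_final
    exact (BimodalLogic.satisfiable_iff_holdsSomewhere φ).trans (BimodalLogic.holdsSomewhere_iff φ)
  -- A FOLTL≠-formula is encoded by the code of its bimodal translation, so the reduction is again
  -- the Gödel numbering.
  · refine ComputablePred.computable_of_manyOneReducible ⟨Encodable.encode,
      Computable.encode, fun φ => ?_⟩ BimodalLogic.computablePred_exists_reachable_final
    exact (BimodalLogic.foSatisfiableExpanding_iff_holdsSomewhere φ).trans
      (BimodalLogic.holdsSomewhere_iff φ.star)
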